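/- Let $h\in\mathbb R[x_1,\dots,x_n]$ be homogeneous of degree $d$ and let $e\in\mathbb R^n$ with $h(e)\neq 0$. For $a\in\mathbb R^n$ put $h_{a,e}(t)=h(a-te)\in\mathbb R[t]$, and let $$\Lambda_e(h)=\{a\in\mathbb R^n\mid \text{all complex zeros of } h_{a,e}(t)\text{ are real and nonnegative}\}.$$ For $k\ge 0$ let $N_k(h_{a,e})$ be the sum of the $k$-th powers of the $d$ complex zeros of $h_{a,e}(t)$, counted with multiplicity; it is a homogeneous polynomial of degree $k$ in $a$, and we define real numbers $c_\alpha$ ($\alpha\in\mathbb N^n$) by $N_k(h_{a,e})=\sum_{|\alpha|=k}c_\alpha a^\alpha$. Let $\mathbb C\langle z\rangle=\mathbb C\langle z_1,\dots,z_n\rangle$ be the free noncommutative algebra with the conjugate-linear involution $*$ that satisfies $z_i^*=z_i$ and $(pq)^*=q^*p^*$, write $a\bullet z=a_1z_1+\dots+a_nz_n$, let $H_\alpha\in\mathbb C\langle z\rangle$ be the sum of all words in which each $z_i$ occurs exactly $\alpha_i$ times, and let $J_e(h)$ be the two-sided ideal of $\mathbb C\langle z\rangle$ generated by the elements $h_{a,e}(a\bullet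 z)$, $a\in\mathbb R^n$, and $1-e\bullet z$. Suppose that there is a $\mathbb C$-linear functional $\varphi\colon\mathbb C\langle z\rangle\to\mathbb C$ which is positive ($\varphi(p^*p)\ge 0$ for all $p$) and a trace ($\varphi(pq)=\varphi(qp)$ for all $p,q$), such that $\varphi(H_\alpha)=c_\alpha$ for all $\alpha\in\mathbb N^n$ with $|\alpha|\le 2d$. Then $h$ is hyperbolic in direction $e$ (that is, for every $a\in\mathbb R^n$ all complex zeros of $h_{a,e}(t)$ are real), $\varphi$ vanishes on $J_e(h)$, and the hyperbolicity cone $\Lambda_e(h)$ is spectrahedral: there are a $k\geq 0$ and hermitian matrices $M_1,\dots,M_n\in\mathrm M_k(\mathbb C)$ with $\Lambda_e(h)=\{a\in\mathbb R^n\mid a_1M_1+\dots+a_nM_n\succeq 0\}$. -/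

import Mathlib

open scoped ComplexOrder

namespace NCHyperbolic

noncomputable section

/-! ### Hyperbolic polynomials, hyperbolicity cones, spectrahedral cones -/

/-- The univariate polynomial `h_{a,e}(t) = h (a - t • e)`. -/
def lineRestriction {n : ℕ} (h : MvPolynomial (Fin n) ℝ) (e a : Fin n → ℝ) : Polynomial ℝ :=
  MvPolynomial.aeval
    (fun i => Polynomial.C (a i) - Polynomial.X * Polynomial.C (e i)) h

/-- The complex zeros of `h_{a,e}(t)`, with multiplicity. -/
def lineZeros {n : ℕ} (h : MvPolynomial (Fin n) ℝ) (e a : Fin n → ℝ) : Multiset ℂ :=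
  (lineRestriction h e a).aroots ℂ

/-- `h` is hyperbolic in direction `e`: it is homogeneous, `h e ≠ 0`, and for every `a ∈ ℝⁿ` all
complex zeros of `h_{a,e}(t)` are real. -/
def IsHyperbolic {n : ℕ} (h : MvPolynomial (Fin n) ℝ) (e : Fin n → ℝ) : Prop :=
  (∃ d : ℕ, h.IsHomogeneous d) ∧ MvPolynomial.eval e h ≠ 0 ∧
    ∀ a : Fin n → ℝ, ∀ z ∈ lineZeros h e a, z.im = 0

/-- `Λ_e(h)`, the set of all `a ∈ ℝⁿ` for which all complex zeros of `h_{a,e}(t)` are real and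
nonnegative. (`0 ≤ z` for `z : ℂ` means that `z` is real and nonnegative.) -/
def hyperbolicityCone {n : ℕ} (h : MvPolynomial (Fin n) ℝ) (e : Fin n → ℝ) :
    Set (Fin n → ℝ) :=
  {a | ∀ z ∈ lineZeros h e a, 0 ≤ z}

/-- A subset of `ℝⁿ` is spectrahedral if it is of the form
`{a | a₁ M₁ + ⋯ + aₙ Mₙ ⪰ 0}` for some complex hermitian matrices `M₁, …, Mₙ` of some size. -/
def IsSpectrahedral {n : ℕ} (S : Set (Fin n → ℝ)) : Prop :=
  ∃ (k : ℕ) (M : Fin n → Matrix (Fin k) (Fin k) ℂ), (∀ i, (M i).IsHermitian) ∧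
    S = {a | (∑ i, (a i : ℂ) • M i).PosSemidef}

/-! ### The free `*`-algebra `ℂ⟨z₁, …, zₙ⟩` -/

/-- `ℂ⟨z₁, …, zₙ⟩`: finite complex linear combinations of words in `n` letters. -/
abbrev NCPoly (n : ℕ) : Type := MonoidAlgebra ℂ (FreeMonoid (Fin n))

/-- The variable `zᵢ`. -/
def z {n : ℕ} (i : Fin n) : NCPoly n := MonoidAlgebra.of ℂ (FreeMonoid (Fin n)) (FreeMonoid.of i)

/-- The involution: words are reversed and coefficients are conjugated. -/
instance instStarNCPoly (n : ℕ) : Star (NCPoly n) where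
  star p := MonoidAlgebra.mapDomain star (MonoidAlgebra.map (starRingEnd ℂ : ℂ →+ ℂ) p)

theorem star_def {n : ℕ} (p : NCPoly n) :
    star p = MonoidAlgebra.mapDomain star (MonoidAlgebra.map (starRingEnd ℂ : ℂ →+ ℂ) p) := rfl

theorem star_single {n : ℕ} (w : FreeMonoid (Fin n)) (c : ℂ) :
    star (MonoidAlgebra.single w c : NCPoly n) = MonoidAlgebra.single (star w) (star c) := by
  simp [star_def]

theorem star_add' {n : ℕ} (p q : NCPoly n) : star (p + q) = star p + star q := by
  simp [star_def, MonoidAlgebra.map_add, MonoidAlgebra.mapDomain_add]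

theorem star_mul' {n : ℕ} (p q : NCPoly n) : star (p * q) = star q * star p := by
  induction p using MonoidAlgebra.induction_linear with
  | zero => simp [star_def]
  | add p₁ p₂ h₁ h₂ => rw [add_mul, star_add', h₁, h₂, star_add', mul_add]
  | single w c =>
    induction q using MonoidAlgebra.induction_linear with
    | zero => simp [star_def]
    | add q₁ q₂ h₁ h₂ => rw [mul_add, star_add', h₁, h₂, star_add', add_mul]
    | single v b =>
      simp only [MonoidAlgebra.single_mul_single, star_single, star_mul]

instance instStarRingNCPoly (n : ℕ) : StarRing (NCPoly n) where
  star_involutive p := by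
    induction p using MonoidAlgebra.induction_linear with
    | zero => simp [star_def]
    | add p q hp hq => rw [star_add', star_add', hp, hq]
    | single w c => rw [star_single, star_single, star_star, star_star]
  star_mul := star_mul'
  star_add := star_add'

instance instStarModuleNCPoly (n : ℕ) : StarModule ℂ (NCPoly n) where
  star_smul c p := by
    induction p using MonoidAlgebra.induction_linear with
    | zero => simp
    | add p q hp hq => rw [smul_add, star_add, hp, hq, star_add, smul_add]
    | single w b => simp [star_single]

theorem star_z {n : ℕ} (i : Fin n) : star (z i) = z i := by
  simp [z, MonoidAlgebra.of_apply, star_single]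

/-- `a ∙ z = a₁ z₁ + ⋯ + aₙ zₙ`. -/
def linForm {n : ℕ} (a : Fin n → ℝ) : NCPoly n := ∑ i, (a i : ℂ) • z i

/-- `J_e(h)`: the two-sided ideal of `ℂ⟨z⟩` generated by all `h_{a,e}(a ∙ z)`, `a ∈ ℝⁿ`, together
with `1 - e ∙ z`. -/
def cliffordIdeal {n : ℕ} (h : MvPolynomial (Fin n) ℝ) (e : Fin n → ℝ) :
    TwoSidedIdeal (NCPoly n) :=
  TwoSidedIdeal.span
    (Set.range (fun a : Fin n → ℝ => Polynomial.aeval (linForm a) (lineRestriction h e a)) ∪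
      {1 - linForm e})

/-- `H_α`: the sum of all words of length `|α|` in which each letter `zᵢ` occurs exactly `αᵢ`
times. -/
def symWord {n : ℕ} (α : Fin n →₀ ℕ) : NCPoly n :=
  ∑ w : Fin (∑ i, α i) → Fin n with ∀ i, (Finset.univ.filter fun j => w j = i).card = α i,
    (List.ofFn fun j => z (w j)).prod

/-- `φ` is a positive trace functional on `ℂ⟨z⟩`. -/
structure IsPositiveTrace {n : ℕ} (φ : NCPoly n →ₗ[ℂ] ℂ) : Prop where
  nonneg : ∀ p : NCPoly n, 0 ≤ φ (star p * p)
  trace : ∀ p q : NCPoly n, φ (p * q) = φ (q * p)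

/-! ### Newton sums -/

/-- The `k`-th Newton sum `N_k(p) = λ₁ᵏ + ⋯ + λ_dᵏ` of a monic polynomial `p` of degree `d` over
a commutative ring, as a polynomial expression in the coefficients of `p`: the power sum in `d`
variables is written as a polynomial in the elementary symmetric polynomials `e₁, …, e_d`, and
`(-1) ^ i` times the coefficient of `p` at `t ^ (d - i)` is substituted for `eᵢ`. -/
def newtonSum {R : Type*} [CommRing R] (p : Polynomial R) (k : ℕ) : R :=
  MvPolynomial.aeval
    (fun i : Fin p.natDegree => (-1) ^ (i.val + 1) * p.coeff (p.natDegree - (i.val + 1)))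
    ((MvPolynomial.esymmAlgEquiv (Fin p.natDegree) ℤ (Fintype.card_fin _)).symm
      ⟨MvPolynomial.psum (Fin p.natDegree) ℤ k, MvPolynomial.psum_isSymmetric _ _ _⟩)

theorem newtonSum_eq_sum_pow {R : Type*} [CommRing R] (p : Polynomial R) (k : ℕ)
    (r : Fin p.natDegree → R) (hp : p = ∏ i, (Polynomial.X - Polynomial.C (r i))) :
    newtonSum p k = ∑ i, r i ^ k := by
  have hc : ∀ i : Fin p.natDegree,
      (-1) ^ (i.val + 1) * p.coeff (p.natDegree - (i.val + 1))
        = MvPolynomial.aeval r (MvPolynomial.esymm (Fin p.natDegree) ℤ (i.val + 1)) := by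
    intro i
    have hs : p = ((Finset.univ.val.map r).map fun x => Polynomial.X - Polynomial.C x).prod := by
      rw [Multiset.map_map]; exact hp
    have hcard : Multiset.card (Finset.univ.val.map r) = p.natDegree := by simp
    have h1 : p.coeff (p.natDegree - (i.val + 1))
        = (-1) ^ (i.val + 1) * (Finset.univ.val.map r).esymm (i.val + 1) := by
      have h0 := Multiset.prod_X_sub_C_coeff (Finset.univ.val.map r)
        (k := p.natDegree - (i.val + 1)) (by rw [hcard]; exact Nat.sub_le _ _)
      rwa [hcard, Nat.sub_sub_self i.isLt, ← hs] at h0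
    rw [h1, ← mul_assoc, ← mul_pow, neg_one_mul, neg_neg, one_pow, one_mul,
      MvPolynomial.aeval_esymm_eq_multiset_esymm]
  have key : ∀ q : MvPolynomial (Fin p.natDegree) ℤ,
      MvPolynomial.aeval (fun i : Fin p.natDegree =>
          (-1) ^ (i.val + 1) * p.coeff (p.natDegree - (i.val + 1))) q
        = MvPolynomial.aeval r
          (MvPolynomial.esymmAlgHom (Fin p.natDegree) ℤ p.natDegree q).val := by
    intro q
    rw [MvPolynomial.esymmAlgHom_apply, ← AlgHom.comp_apply, MvPolynomial.comp_aeval]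
    congr 2
    funext i
    exact hc i
  rw [newtonSum, key]
  have h2 := AlgEquiv.apply_symm_apply
    (MvPolynomial.esymmAlgEquiv (Fin p.natDegree) ℤ (Fintype.card_fin p.natDegree))
    ⟨MvPolynomial.psum (Fin p.natDegree) ℤ k, MvPolynomial.psum_isSymmetric _ _ _⟩
  have h3 := congrArg Subtype.val h2
  change (MvPolynomial.esymmAlgHom (Fin p.natDegree) ℤ p.natDegree _).val = _ at h3
  rw [h3]
  simp [MvPolynomial.psum]

/-- `newtonSum` is the sum of the `k`-th powers of the zeros. -/
theorem newtonSum_prod {R : Type*} [CommRing R] [Nontrivial R] (s : Multiset R) (k : ℕ) :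
    newtonSum (s.map fun r => Polynomial.X - Polynomial.C r).prod k
      = (s.map fun r => r ^ k).sum := by
  obtain ⟨l, rfl⟩ : ∃ l : List R, s = l := ⟨s.toList, by simp⟩
  have hdeg : ((l : Multiset R).map fun r => Polynomial.X - Polynomial.C r).prod.natDegree
      = l.length := by
    simpa using Polynomial.natDegree_multiset_prod_X_sub_C_eq_card (l : Multiset R)
  rw [newtonSum_eq_sum_pow _ k (fun i => l.get (i.cast hdeg))]
  · refine (Fintype.sum_equiv (finCongr hdeg) _ (fun i => l.get i ^ k) (fun i => rfl)).trans ?_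
    rw [← List.sum_ofFn, Multiset.map_coe, Multiset.sum_coe]
    congr 1
    conv_rhs => rw [← List.ofFn_get l, List.map_ofFn]
    rfl
  · refine Eq.trans ?_ (Fintype.prod_equiv (finCongr hdeg) _
      (fun i => Polynomial.X - Polynomial.C (l.get i)) (fun i => rfl)).symm
    rw [← List.prod_ofFn, Multiset.map_coe, Multiset.prod_coe]
    congr 1
    conv_lhs => rw [← List.ofFn_get l, List.map_ofFn]
    rfl

/-- Newton sums are compatible with ring homomorphisms that preserve the degree. -/
theorem map_newtonSum {R S : Type*} [CommRing R] [CommRing S] (f : R →+* S) (p : Polynomial R)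
    (hp : (p.map f).natDegree = p.natDegree) (k : ℕ) :
    f (newtonSum p k) = newtonSum (p.map f) k := by
  have aux : ∀ (m : ℕ) (hm : m = p.natDegree),
      f (newtonSum p k) = MvPolynomial.aeval
        (fun i : Fin m => (-1) ^ (i.val + 1) * (p.map f).coeff (m - (i.val + 1)))
        ((MvPolynomial.esymmAlgEquiv (Fin m) ℤ (Fintype.card_fin _)).symm
          ⟨MvPolynomial.psum (Fin m) ℤ k, MvPolynomial.psum_isSymmetric _ _ _⟩) := by
    rintro m rfl
    rw [newtonSum]
    generalize (MvPolynomial.esymmAlgEquiv (Fin p.natDegree) ℤ (Fintype.card_fin _)).symm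
      ⟨MvPolynomial.psum (Fin p.natDegree) ℤ k, MvPolynomial.psum_isSymmetric _ _ _⟩ = q
    change f.toIntAlgHom (MvPolynomial.aeval _ q) = _
    rw [← AlgHom.comp_apply, MvPolynomial.comp_aeval]
    congr 2
    funext i
    simp
  exact aux _ hp

/-- For homogeneous `h` of degree `d` with `h e ≠ 0`, this is `h (x - t • e)` as a polynomial in `t`
with coefficients in `ℝ[x]`, divided by its leading coefficient `(-1) ^ d * h e`. -/
def monicLine {n : ℕ} (h : MvPolynomial (Fin n) ℝ) (e : Fin n → ℝ) :
    Polynomial (MvPolynomial (Fin n) ℝ) :=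
  Polynomial.C (MvPolynomial.C ((-1) ^ h.totalDegree * MvPolynomial.eval e h)⁻¹) *
    MvPolynomial.aeval (fun i => Polynomial.C (MvPolynomial.X i) -
      Polynomial.X * Polynomial.C (MvPolynomial.C (e i))) h

/-- `N_k(h_{x,e}(t))` as a polynomial in `x`. -/
def newtonPoly {n : ℕ} (h : MvPolynomial (Fin n) ℝ) (e : Fin n → ℝ) (k : ℕ) :
    MvPolynomial (Fin n) ℝ :=
  newtonSum (monicLine h e) k

theorem map_monicLine {n : ℕ} {h : MvPolynomial (Fin n) ℝ} {e : Fin n → ℝ}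
    (a : Fin n → ℝ) :
    (monicLine h e).map (MvPolynomial.eval a)
      = Polynomial.C ((-1) ^ h.totalDegree * MvPolynomial.eval e h)⁻¹ *
        lineRestriction h e a := by
  rw [monicLine, Polynomial.map_mul, Polynomial.map_C, MvPolynomial.eval_C, lineRestriction]
  congr 1
  have : ((Polynomial.mapAlgHom (MvPolynomial.aeval a : MvPolynomial (Fin n) ℝ →ₐ[ℝ] ℝ)).comp
      (MvPolynomial.aeval fun i => Polynomial.C (MvPolynomial.X i) -
        Polynomial.X * Polynomial.C (MvPolynomial.C (e i)) : MvPolynomial (Fin n) ℝ →ₐ[ℝ] _))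
      = MvPolynomial.aeval fun i => Polynomial.C (a i) - Polynomial.X * Polynomial.C (e i) := by
    ext i : 1
    simp
  exact DFunLike.congr_fun this h

theorem natDegree_coeff_prod {ι R : Type*} [CommRing R] (s : Finset ι) (b c : ι → R)
    (m : ι → ℕ) :
    (∏ i ∈ s, (Polynomial.C (b i) - Polynomial.X * Polynomial.C (c i)) ^ m i).natDegree
        ≤ ∑ i ∈ s, m i ∧
      (∏ i ∈ s, (Polynomial.C (b i) - Polynomial.X * Polynomial.C (c i)) ^ m i).coeff
        (∑ i ∈ s, m i) = ∏ i ∈ s, (-c i) ^ m i := by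
  classical
  induction s using Finset.induction_on with
  | empty => simp
  | insert j s hj ih =>
    have h1 : (Polynomial.C (b j) - Polynomial.X * Polynomial.C (c j)).natDegree ≤ 1 := by
      compute_degree
    have h2 : ((Polynomial.C (b j) - Polynomial.X * Polynomial.C (c j)) ^ m j).natDegree
        ≤ m j := by
      simpa using Polynomial.natDegree_pow_le_of_le (m j) h1
    have h3 : ((Polynomial.C (b j) - Polynomial.X * Polynomial.C (c j)) ^ m j).coeff (m j)
        = (-c j) ^ m j := by
      have := Polynomial.coeff_pow_of_natDegree_le (m := m j) (n := 1) h1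
      rw [mul_one] at this
      rw [this]
      simp [Polynomial.coeff_C]
    rw [Finset.prod_insert hj, Finset.sum_insert hj, Finset.prod_insert hj]
    exact ⟨Polynomial.natDegree_mul_le_of_le h2 ih.1,
      by rw [Polynomial.coeff_mul_add_eq_of_natDegree_le h2 ih.1, h3, ih.2]⟩

theorem monicLine_spec {n d : ℕ} {h : MvPolynomial (Fin n) ℝ} {e : Fin n → ℝ}
    (hd : h.IsHomogeneous d) (he : MvPolynomial.eval e h ≠ 0) :
    (monicLine h e).natDegree = d ∧ (monicLine h e).Monic := by
  have hh : h ≠ 0 := by rintro rfl; simp at he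
  have hu0 : (-1) ^ d * MvPolynomial.eval e h ≠ 0 := mul_ne_zero (pow_ne_zero _ (by norm_num)) he
  have hsum : ∀ α ∈ h.support, ∑ i, α i = d := by
    intro α hα
    have := hd (MvPolynomial.mem_support_iff.mp hα)
    rwa [Finsupp.weight_apply, Finsupp.sum_fintype _ _ (by simp), Finset.sum_congr rfl
      (fun i _ => by simp : ∀ i ∈ Finset.univ, α i • (1 : Fin n → ℕ) i = α i)] at this
  have hle : (monicLine h e).natDegree ≤ d := by
    rw [monicLine]
    refine (Polynomial.natDegree_C_mul_le _ _).trans ?_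
    rw [MvPolynomial.aeval_def, MvPolynomial.eval₂_eq']
    refine Polynomial.natDegree_sum_le_of_forall_le _ _ fun α hα => ?_
    refine (Polynomial.natDegree_C_mul_le _ _).trans ?_
    rw [← hsum α hα]
    exact (natDegree_coeff_prod _ _ _ _).1
  have hco : (monicLine h e).coeff d = 1 := by
    rw [monicLine, hd.totalDegree hh, Polynomial.coeff_C_mul, MvPolynomial.aeval_def,
      MvPolynomial.eval₂_eq', Polynomial.finsetSum_coeff]
    have : ∀ α ∈ h.support, ((algebraMap ℝ (Polynomial (MvPolynomial (Fin n) ℝ)))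
        (MvPolynomial.coeff α h) * ∏ i, (Polynomial.C (MvPolynomial.X i) -
          Polynomial.X * Polynomial.C (MvPolynomial.C (e i))) ^ α i).coeff d
        = MvPolynomial.C ((-1) ^ d * (MvPolynomial.coeff α h * ∏ i, e i ^ α i)) := by
      intro α hα
      change (Polynomial.C (MvPolynomial.C (MvPolynomial.coeff α h)) * _).coeff d = _
      rw [Polynomial.coeff_C_mul, ← hsum α hα, (natDegree_coeff_prod _ _ _ _).2]
      simp_rw [neg_pow (MvPolynomial.C (e _)), Finset.prod_mul_distrib, Finset.prod_pow_eq_pow_sum]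
      simp only [map_mul, map_pow, map_prod, map_neg, map_one]
      ring
    rw [Finset.sum_congr rfl this, ← map_sum, ← map_mul, ← Finset.mul_sum,
      ← MvPolynomial.eval_eq', inv_mul_cancel₀ hu0, map_one]
  exact ⟨Polynomial.natDegree_eq_of_le_of_coeff_ne_zero hle (by rw [hco]; exact one_ne_zero),
    Polynomial.monic_of_natDegree_le_of_coeff_eq_one d hle hco⟩

/-- At each `a ∈ ℝⁿ`, `newtonPoly h e k` is the sum of the `k`-th powers of the zeros of
`h_{a,e}(t)`. -/
theorem eval_newtonPoly {n d : ℕ} {h : MvPolynomial (Fin n) ℝ} {e : Fin n → ℝ}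
    (hd : h.IsHomogeneous d) (he : MvPolynomial.eval e h ≠ 0) (k : ℕ) (a : Fin n → ℝ) :
    ((MvPolynomial.eval a (newtonPoly h e k) : ℝ) : ℂ)
      = ((lineZeros h e a).map fun r => r ^ k).sum := by
  have hh : h ≠ 0 := by rintro rfl; simp at he
  have htd : h.totalDegree = d := hd.totalDegree hh
  set u : ℝ := (-1) ^ d * MvPolynomial.eval e h with hu
  have hu0 : u ≠ 0 := mul_ne_zero (pow_ne_zero _ (by norm_num)) he
  obtain ⟨hdeg, hmonic⟩ := monicLine_spec hd he
  have hmap := map_monicLine (h := h) (e := e) a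
  have hmonic' := hmonic.map (MvPolynomial.eval a)
  have hdeg' : ((monicLine h e).map (MvPolynomial.eval a)).natDegree
      = (monicLine h e).natDegree := hmonic.natDegree_map _
  rw [newtonPoly, map_newtonSum _ _ hdeg']
  have hC := map_newtonSum (algebraMap ℝ ℂ) ((monicLine h e).map (MvPolynomial.eval a))
    ((hmonic'.natDegree_map _)) k
  rw [Complex.coe_algebraMap] at hC
  rw [hC]
  have hroots : (((monicLine h e).map (MvPolynomial.eval a)).map Complex.ofRealHom).roots
      = lineZeros h e a := by
    rw [hmap, lineZeros, Polynomial.aroots_def, Polynomial.map_mul, Polynomial.map_C,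
      Polynomial.roots_C_mul _ (by rw [htd, ← hu]; simpa using inv_ne_zero hu0)]
    rfl
  have hsplit := (IsAlgClosed.splits
    (((monicLine h e).map (MvPolynomial.eval a)).map Complex.ofRealHom))
  have hprod := hsplit.eq_prod_roots_of_monic (hmonic'.map _)
  rw [hroots] at hprod
  change newtonSum (((monicLine h e).map (MvPolynomial.eval a)).map Complex.ofRealHom) k = _
  rw [hprod, newtonSum_prod]

/-- `c_α`: the coefficient of `a ^ α` in `N_{|α|}(h_{a,e}(t))`. -/
def newtonCoeff {n : ℕ} (h : MvPolynomial (Fin n) ℝ) (e : Fin n → ℝ) (α : Fin n →₀ ℕ) : ℝ :=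
  (newtonPoly h e (∑ i, α i)).coeff α

end

end NCHyperbolic

namespace NCHyperbolic

/-! ### Positive traces: Cauchy–Schwarz and the null ideal. -/

section Traces

variable {n : ℕ} {φ : NCPoly n →ₗ[ℂ] ℂ}

/-! The hypothesis says that, up to order `2 * d`, the moments of the self-adjoint element `a ∙ z`
under `φ` are those of the counting measure on the `d` zeros of `h_{a,e}` (`hasMoments_lineZeros`).
Because `φ` is a positive trace, the `p` with `φ (p* p) = 0` form a two-sided ideal on which `φ`
vanishes (`nullIdeal`). If a polynomial `p` of degree at most `d` vanishes at the zeros, the moments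
give `φ (p(a ∙ z)* p(a ∙ z)) = 0`. So `a ∙ z` behaves modulo this ideal like an operator with
spectrum in the zero set.

Everything follows. A nonreal zero would have a Lagrange indicator that is null but has nonzero
trace. The generators of `J_e(h)` are null. If the zeros are nonnegative, `a ∙ z` has a square root
modulo the ideal, so `P ↦ φ (P* (a ∙ z) P)` is nonnegative; conversely, testing this form on the
indicator of a zero `r` gives a positive multiple of `r`. Those test elements have degree below `d`,
so the form on short words is a finite linear matrix pencil that describes the cone. -/

theorem IsPositiveTrace.map_star (hφ : IsPositiveTrace φ) (p : NCPoly n) :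
    φ (star p) = star (φ p) := by
  have key (q : NCPoly n) : (φ q + φ (star q)).im = 0 := by
    have h1 := (Complex.nonneg_iff.mp (hφ.nonneg (1 + q))).2
    have h2 := (Complex.nonneg_iff.mp (hφ.nonneg 1)).2
    have h3 := (Complex.nonneg_iff.mp (hφ.nonneg q)).2
    simp only [star_add, star_one, add_mul, mul_add, one_mul, mul_one, map_add, Complex.add_im]
      at h1 h2 h3 ⊢
    linarith
  have h1 := key p
  -- `key p` compares imaginary parts; rotating by `I` compares real parts.
  have h2 := key (Complex.I • p)
  simp only [star_smul, map_smul, smul_eq_mul] at h2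
  apply Complex.ext <;> simp at h1 h2 ⊢ <;> linarith

/-- The Cauchy–Schwarz inequality in the degenerate case. -/
theorem IsPositiveTrace.map_star_mul_eq_zero (hφ : IsPositiveTrace φ) {p : NCPoly n}
    (hp : φ (star p * p) = 0) (q : NCPoly n) : φ (star q * p) = 0 := by
  set c := φ (star q * p) with hc
  have hc' : φ (star p * q) = star c := by
    rw [hc, ← hφ.map_star, star_mul, star_star]
  -- The term quadratic in `t` carries the factor `φ (p* p) = 0`, so the bound is affine in `t`. The
  -- `t` used below would make the right side `-1`.
  have key (t : ℝ) : 0 ≤ (φ (star q * q)).re - 2 * t * Complex.normSq c := by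
    have h1 := (Complex.nonneg_iff.mp (hφ.nonneg (q - ((t : ℂ) * star c) • p))).1
    simp only [star_sub, star_smul, sub_mul, mul_sub, smul_mul_assoc, mul_smul_comm, map_sub,
      map_smul, hp, ← hc, hc', smul_eq_mul] at h1
    simp [Complex.normSq_apply] at h1 ⊢
    linarith
  by_contra hne
  have hpos := Complex.normSq_pos.mpr hne
  have h2 := key (((φ (star q * q)).re + 1) / (2 * Complex.normSq c))
  have h3 : 2 * (((φ (star q * q)).re + 1) / (2 * Complex.normSq c)) * Complex.normSq c
      = (φ (star q * q)).re + 1 := by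
    field_simp
  linarith

/-- The elements `p` with `φ (p* p) = 0`. -/
noncomputable def nullIdeal (hφ : IsPositiveTrace φ) : TwoSidedIdeal (NCPoly n) :=
  TwoSidedIdeal.mk' {p | φ (star p * p) = 0} (by simp)
    (fun {x y} hx hy => by
      have hx' := hφ.map_star_mul_eq_zero hx
      have hy' := hφ.map_star_mul_eq_zero hy
      change φ (star (x + y) * (x + y)) = 0
      rw [mul_add, map_add, hx', hy', add_zero])
    (fun {x} hx => by simpa using hx)
    (fun {x y} hy => by
      have := hφ.map_star_mul_eq_zero hy (star x * (x * y))
      rw [star_mul, star_star] at this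
      simpa [mul_assoc] using this)
    -- Closure under right multiplication uses the trace property: `φ ((xy)* xy) = φ (x y y* x*) = φ
    -- ((x y y*)* x)`, which vanishes by Cauchy–Schwarz.
    (fun {x y} hx => by
      have := hφ.map_star_mul_eq_zero (p := x) hx (x * (y * star y))
      change φ (star (x * y) * (x * y)) = 0
      rw [hφ.trace, star_mul]
      rw [star_mul, star_mul, star_star, hφ.trace] at this
      simpa [mul_assoc] using this)

theorem mem_nullIdeal (hφ : IsPositiveTrace φ) {p : NCPoly n} :
    p ∈ nullIdeal hφ ↔ φ (star p * p) = 0 :=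
  TwoSidedIdeal.mem_mk' ..

theorem map_eq_zero_of_mem_nullIdeal (hφ : IsPositiveTrace φ) {p : NCPoly n}
    (hp : p ∈ nullIdeal hφ) : φ p = 0 := by
  simpa using hφ.map_star_mul_eq_zero ((mem_nullIdeal hφ).mp hp) 1

end Traces

/-! ### Powers of linear forms as sums over words. -/

theorem star_linForm {n : ℕ} (a : Fin n → ℝ) : star (linForm a) = linForm a := by
  simp [linForm, star_sum, star_smul, star_z]

theorem star_aeval_linForm {n : ℕ} (a : Fin n → ℝ) (p : Polynomial ℂ) :
    star (Polynomial.aeval (linForm a) p)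
      = Polynomial.aeval (linForm a) (p.map (starRingEnd ℂ)) := by
  induction p using Polynomial.induction_on' with
  | add p q hp hq => simp [hp, hq]
  | monomial k c =>
    simp [Polynomial.aeval_monomial, star_pow, star_linForm, Algebra.algebraMap_eq_smul_one,
      star_smul]

theorem sum_pow_eq_sum_ofFn {ι R : Type*} [Fintype ι] [Semiring R] (f : ι → R) (k : ℕ) :
    (∑ i, f i) ^ k = ∑ w : Fin k → ι, (List.ofFn fun j => f (w j)).prod := by
  induction k with
  | zero => simp
  | succ k ih =>
    rw [pow_succ', ih, ← (Fin.consEquiv fun _ : Fin (k + 1) => ι).sum_comp, Fintype.sum_prod_type,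
      Finset.sum_mul]
    refine Finset.sum_congr rfl fun i _ => ?_
    rw [Finset.mul_sum]
    exact Finset.sum_congr rfl fun w _ => by simp [Fin.consEquiv]

/-- The word with letters `w 0, w 1, …`. -/
noncomputable def wordOf {n k : ℕ} (w : Fin k → Fin n) : NCPoly n :=
  (List.ofFn fun j => z (w j)).prod

theorem linForm_pow {n : ℕ} (a : Fin n → ℝ) (k : ℕ) :
    linForm a ^ k = ∑ w : Fin k → Fin n, ((∏ j, a (w j) : ℝ) : ℂ) • wordOf w := by
  rw [linForm, sum_pow_eq_sum_ofFn]
  refine Finset.sum_congr rfl fun w _ => ?_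
  rw [wordOf]
  induction k with
  | zero => simp
  | succ k ih =>
    simp only [List.ofFn_succ, List.prod_cons, Fin.prod_univ_succ]
    rw [ih (fun j => w j.succ) (Finset.mem_univ _), smul_mul_smul_comm]
    simp

theorem symWord_eq {n k : ℕ} {α : Fin n →₀ ℕ} (hα : ∑ i, α i = k) :
    symWord α = ∑ w : Fin k → Fin n with
      ∀ i, (Finset.univ.filter fun j => w j = i).card = α i, wordOf w := by
  subst hα
  rfl

/-- Words are grouped by their letter counts; all words in one group have the same coefficient.
Hence the values of `φ` on the `H_α` determine all moments of every `a ∙ z`. -/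
theorem linForm_pow_eq_sum_symWord {n : ℕ} (a : Fin n → ℝ) (k : ℕ) :
    linForm a ^ k = ∑ α ∈ Finset.univ.finsuppAntidiag k,
      ((∏ i, a i ^ α i : ℝ) : ℂ) • symWord α := by
  rw [linForm_pow, ← Finset.sum_fiberwise_of_maps_to (t := Finset.univ.finsuppAntidiag k)
    (g := fun w : Fin k → Fin n => Finsupp.equivFunOnFinite.symm
      fun i => (Finset.univ.filter fun j => w j = i).card)]
  · refine Finset.sum_congr rfl fun α hα => ?_
    rw [symWord_eq (Finset.mem_finsuppAntidiag.mp hα).1, Finset.smul_sum]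
    refine Finset.sum_congr (by ext w; simp [Finsupp.ext_iff]) fun w hw => ?_
    have hw' := (Finset.mem_filter.mp hw).2
    congr 2
    rw [← Finset.prod_fiberwise Finset.univ w]
    refine Finset.prod_congr rfl fun i _ => ?_
    rw [Finset.prod_congr rfl (fun j hj => by rw [(Finset.mem_filter.mp hj).2] :
      ∀ j ∈ Finset.univ.filter (fun j => w j = i), a (w j) = a i), Finset.prod_const]
    congr 1
    simp [← hw']
  · intro w _
    simp only [Finset.mem_finsuppAntidiag, Finset.subset_univ, and_true]
    simpa using (Finset.card_eq_sum_card_fiberwise (s := Finset.univ) (t := Finset.univ) (f := w)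
      (by simp)).symm

/-! ### Zeros of the line restrictions and homogeneity of the Newton sums. -/

section Zeros

variable {n d : ℕ} {h : MvPolynomial (Fin n) ℝ} {e : Fin n → ℝ}

theorem aeval_smul_of_isHomogeneous {A : Type*} [CommRing A] [Algebra ℝ A]
    (hd : h.IsHomogeneous d) (c : A) (f : Fin n → A) :
    MvPolynomial.aeval (fun i => c * f i) h = c ^ d * MvPolynomial.aeval f h := by
  rw [MvPolynomial.aeval_def, MvPolynomial.aeval_def, MvPolynomial.eval₂_eq',
    MvPolynomial.eval₂_eq', Finset.mul_sum]
  refine Finset.sum_congr rfl fun α hα => ?_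
  have hα' := hd (MvPolynomial.mem_support_iff.mp hα)
  rw [Finsupp.weight_apply, Finsupp.sum_fintype _ _ (by simp)] at hα'
  simp only [Pi.one_apply, smul_eq_mul, mul_one] at hα'
  simp_rw [mul_pow, Finset.prod_mul_distrib, Finset.prod_pow_eq_pow_sum, hα']
  ring

theorem lineRestriction_smul_comp (hd : h.IsHomogeneous d) (a : Fin n → ℝ) (t : ℝ) :
    (lineRestriction h e (t • a)).comp (Polynomial.C t * Polynomial.X)
      = Polynomial.C t ^ d * lineRestriction h e a := by
  rw [lineRestriction, lineRestriction, ← aeval_smul_of_isHomogeneous hd]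
  have : ((Polynomial.aeval (Polynomial.C t * Polynomial.X) :
      Polynomial ℝ →ₐ[ℝ] Polynomial ℝ).comp
      (MvPolynomial.aeval fun i => Polynomial.C ((t • a) i) - Polynomial.X * Polynomial.C (e i) :
        MvPolynomial (Fin n) ℝ →ₐ[ℝ] _))
      = MvPolynomial.aeval fun i => Polynomial.C t *
        (Polynomial.C (a i) - Polynomial.X * Polynomial.C (e i)) := by
    ext i : 1
    simp
    ring
  exact DFunLike.congr_fun this h

theorem lineZeros_smul (hd : h.IsHomogeneous d) (a : Fin n → ℝ) {t : ℝ} (ht : t ≠ 0) :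
    lineZeros h e (t • a) = (lineZeros h e a).map fun r => (t : ℂ) * r := by
  have ht' : (t : ℂ) ≠ 0 := by exact_mod_cast ht
  have h1 := congrArg (Polynomial.map (algebraMap ℝ ℂ))
    (lineRestriction_smul_comp (e := e) hd a t)
  have h2 := Polynomial.map_roots_comp_C_mul_X_add_C
    ((lineRestriction h e (t • a)).map (algebraMap ℝ ℂ)) (t : ℂ) 0 ht'.isUnit
  simp only [Polynomial.map_comp, Polynomial.map_mul, Polynomial.map_C, Polynomial.map_X,
    Complex.coe_algebraMap, ← Polynomial.C_pow] at h1
  simp only [map_zero, add_zero] at h2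
  have h3 : lineZeros h e (t • a)
      = ((lineRestriction h e (t • a)).map (algebraMap ℝ ℂ)).roots := rfl
  have h4 : lineZeros h e a = ((lineRestriction h e a).map (algebraMap ℝ ℂ)).roots := rfl
  rw [h3, h4, ← h2]
  congr 1
  refine (congrArg Polynomial.roots h1).trans ?_
  exact Polynomial.roots_C_mul _ (by exact_mod_cast pow_ne_zero d ht)

/-- A polynomial function that is homogeneous off zero comes from a single homogeneous
component. -/
theorem eval_eq_eval_homogeneousComponent {P : MvPolynomial (Fin n) ℝ} {k : ℕ} {a : Fin n → ℝ}
    (hP : ∀ t : ℝ, t ≠ 0 → MvPolynomial.eval (t • a) P = t ^ k * MvPolynomial.eval a P) :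
    MvPolynomial.eval a P = MvPolynomial.eval a (MvPolynomial.homogeneousComponent k P) := by
  set N := P.totalDegree + k + 1 with hN
  have hsum : ∑ j ∈ Finset.range N, MvPolynomial.homogeneousComponent j P = P := by
    conv_rhs => rw [← MvPolynomial.sum_homogeneousComponent P]
    symm
    refine Finset.sum_subset (Finset.range_subset_range.mpr (by omega)) fun j _ hj => ?_
    exact MvPolynomial.homogeneousComponent_eq_zero _ _ (by simpa using hj)
  set Q : Polynomial ℝ := ∑ j ∈ Finset.range N,
    Polynomial.monomial j (MvPolynomial.eval a (MvPolynomial.homogeneousComponent j P)) with hQ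
  have hQe (t : ℝ) : Q.eval t = MvPolynomial.eval (t • a) P := by
    conv_rhs => rw [← hsum]
    rw [hQ, Polynomial.eval_finsetSum, map_sum]
    refine Finset.sum_congr rfl fun j _ => ?_
    have := aeval_smul_of_isHomogeneous
      (MvPolynomial.homogeneousComponent_isHomogeneous j P) t a
    rw [Polynomial.eval_monomial, mul_comm]
    exact this.symm
  -- The factor `X` absorbs `t = 0`, where the scaling hypothesis says nothing.
  have hQ' : Polynomial.X * Q
      = Polynomial.X * Polynomial.monomial k (MvPolynomial.eval a P) := by
    refine Polynomial.funext fun t => ?_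
    rcases eq_or_ne t 0 with rfl | ht
    · simp
    · simp only [Polynomial.eval_mul, Polynomial.eval_X, hQe, hP t ht, Polynomial.eval_monomial]
      ring
  have hQ'' := congrArg (fun p => Polynomial.coeff p k) (mul_left_cancel₀ Polynomial.X_ne_zero hQ')
  simp only [hQ, Polynomial.finsetSum_coeff, Polynomial.coeff_monomial, Finset.sum_ite_eq',
    if_true] at hQ''
  rw [← hQ'', if_pos (Finset.mem_range.mpr (by omega))]

/-- Homogeneity of the Newton sum is read off from its values: replacing `a` by `t • a` with `t ≠ 0`
multiplies all zeros by `t`, so only the component of degree `k` contributes. -/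
theorem eval_newtonPoly_eq_sum (hd : h.IsHomogeneous d) (he : MvPolynomial.eval e h ≠ 0) (k : ℕ)
    (a : Fin n → ℝ) :
    MvPolynomial.eval a (newtonPoly h e k)
      = ∑ α ∈ Finset.univ.finsuppAntidiag k, newtonCoeff h e α * ∏ i, a i ^ α i := by
  rw [eval_eq_eval_homogeneousComponent (k := k), MvPolynomial.eval_eq']
  · refine Eq.trans (Finset.sum_subset (s₂ := Finset.univ.finsuppAntidiag k) ?_ ?_) ?_
    · intro α hα
      rw [MvPolynomial.mem_support_iff, MvPolynomial.coeff_homogeneousComponent] at hα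
      simp only [Finset.mem_finsuppAntidiag, Finset.subset_univ, and_true]
      rw [← Finsupp.degree_eq_sum]
      by_contra hne
      exact hα (if_neg hne)
    · intro α _ hα
      rw [MvPolynomial.notMem_support_iff.mp hα, zero_mul]
    · refine Finset.sum_congr rfl fun α hα => ?_
      have hα' := (Finset.mem_finsuppAntidiag.mp hα).1
      rw [MvPolynomial.coeff_homogeneousComponent, if_pos (by rw [Finsupp.degree_eq_sum, hα']),
        newtonCoeff, hα']
  · intro t ht
    have := eval_newtonPoly hd he k (t • a)
    rw [lineZeros_smul hd a ht, Multiset.map_map] at this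
    simp only [Function.comp_apply, mul_pow, Multiset.sum_map_mul_left,
      ← eval_newtonPoly hd he k a] at this
    exact_mod_cast this

theorem lineRestriction_ne_zero (hd : h.IsHomogeneous d) (he : MvPolynomial.eval e h ≠ 0)
    (a : Fin n → ℝ) : lineRestriction h e a ≠ 0 := by
  intro h0
  have h1 := map_monicLine (h := h) (e := e) a
  rw [h0, mul_zero] at h1
  exact ((monicLine_spec hd he).2.map _).ne_zero h1

theorem natDegree_lineRestriction (hd : h.IsHomogeneous d) (he : MvPolynomial.eval e h ≠ 0)
    (a : Fin n → ℝ) : (lineRestriction h e a).natDegree = d := by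
  have hh : h ≠ 0 := by rintro rfl; simp at he
  have h1 := map_monicLine (h := h) (e := e) a
  rw [← (monicLine_spec hd he).1, ← (monicLine_spec hd he).2.natDegree_map (MvPolynomial.eval a),
    h1, Polynomial.natDegree_C_mul (inv_ne_zero (mul_ne_zero (pow_ne_zero _ (by norm_num)) he))]

theorem card_lineZeros (hd : h.IsHomogeneous d) (he : MvPolynomial.eval e h ≠ 0)
    (a : Fin n → ℝ) : Multiset.card (lineZeros h e a) = d := by
  rw [lineZeros, Polynomial.aroots_def, ← (IsAlgClosed.splits _).natDegree_eq_card_roots,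
    Polynomial.natDegree_map, natDegree_lineRestriction hd he]

theorem mem_lineZeros (hd : h.IsHomogeneous d) (he : MvPolynomial.eval e h ≠ 0)
    {a : Fin n → ℝ} {r : ℂ} :
    r ∈ lineZeros h e a ↔ Polynomial.aeval r (lineRestriction h e a) = 0 := by
  rw [lineZeros, Polynomial.mem_aroots]
  exact and_iff_right (lineRestriction_ne_zero hd he a)

theorem star_mem_lineZeros (hd : h.IsHomogeneous d) (he : MvPolynomial.eval e h ≠ 0)
    {a : Fin n → ℝ} {r : ℂ} (hr : r ∈ lineZeros h e a) : star r ∈ lineZeros h e a := by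
  rw [mem_lineZeros hd he] at hr ⊢
  have := Polynomial.aeval_conj (lineRestriction h e a) r
  rw [hr, map_zero] at this
  exact this

theorem eq_one_of_mem_lineZeros_self (hd : h.IsHomogeneous d) (he : MvPolynomial.eval e h ≠ 0)
    {r : ℂ} (hr : r ∈ lineZeros h e e) : r = 1 := by
  rw [mem_lineZeros hd he] at hr
  have h1 : lineRestriction h e e
      = (1 - Polynomial.X) ^ d * Polynomial.C (MvPolynomial.eval e h) := by
    have h2 := aeval_smul_of_isHomogeneous hd (1 - Polynomial.X : Polynomial ℝ)
      (fun i => Polynomial.C (e i))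
    have h3 : (MvPolynomial.aeval fun i => Polynomial.C (e i)) h
        = Polynomial.C (MvPolynomial.eval e h) :=
      MvPolynomial.aeval_algebraMap_apply (Polynomial ℝ) e h
    rw [← h3, ← h2, lineRestriction]
    congr 2
    funext i
    ring
  rw [h1] at hr
  simp only [map_mul, map_pow, map_sub, map_one, Polynomial.aeval_X, Polynomial.aeval_C,
    mul_eq_zero] at hr
  rcases hr with hr | hr
  · exact (sub_eq_zero.mp (eq_zero_of_pow_eq_zero hr)).symm
  · exact absurd (by simpa using hr) he

end Zeros

/-! ### Moments of `a ∙ z` and the resulting functional calculus. -/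

section Moments

variable {n d : ℕ} {h : MvPolynomial (Fin n) ℝ} {e : Fin n → ℝ} {φ : NCPoly n →ₗ[ℂ] ℂ}

/-- The moments of `a ∙ z` under `φ` up to order `2 d` are the power sums of `S`. -/
def HasMoments (φ : NCPoly n →ₗ[ℂ] ℂ) (d : ℕ) (a : Fin n → ℝ) (S : Multiset ℂ) : Prop :=
  ∀ p : Polynomial ℂ, p.natDegree ≤ 2 * d →
    φ (Polynomial.aeval (linForm a) p) = (S.map fun r => p.eval r).sum

theorem hasMoments_lineZeros (hd : h.IsHomogeneous d) (he : MvPolynomial.eval e h ≠ 0)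
    (hc : ∀ α : Fin n →₀ ℕ, ∑ i, α i ≤ 2 * d → φ (symWord α) = (newtonCoeff h e α : ℂ))
    (a : Fin n → ℝ) : HasMoments φ d a (lineZeros h e a) := by
  intro p hp
  have hpow (k : ℕ) (hk : k ≤ 2 * d) :
      φ (linForm a ^ k) = ((lineZeros h e a).map fun r => r ^ k).sum := by
    rw [← eval_newtonPoly hd he, eval_newtonPoly_eq_sum hd he, linForm_pow_eq_sum_symWord, map_sum,
      Complex.ofReal_sum]
    refine Finset.sum_congr rfl fun α hα => ?_
    rw [map_smul, hc α (by rw [(Finset.mem_finsuppAntidiag.mp hα).1]; exact hk), smul_eq_mul,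
      mul_comm, Complex.ofReal_mul]
  rw [Polynomial.aeval_eq_sum_range, map_sum]
  simp only [Polynomial.eval_eq_sum_range, map_smul, smul_eq_mul]
  rw [Multiset.sum_map_sum]
  refine Finset.sum_congr rfl fun k hk => ?_
  rw [Multiset.sum_map_mul_left, hpow k (by have := Finset.mem_range.mp hk; omega)]

variable {a : Fin n → ℝ} {S : Multiset ℂ}

/-- Since `a ∙ z` is self-adjoint, the star only conjugates the coefficients of `p`. The points of
`S` are not assumed real, hence the evaluation at `star r`. -/
theorem HasMoments.map_star_mul (hS : HasMoments φ d a S) {p q : Polynomial ℂ}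
    (hpq : p.natDegree + q.natDegree ≤ 2 * d) :
    φ (star (Polynomial.aeval (linForm a) p) * Polynomial.aeval (linForm a) q)
      = (S.map fun r => star (p.eval (star r)) * q.eval r).sum := by
  rw [star_aeval_linForm, ← map_mul, hS]
  · refine congrArg Multiset.sum (Multiset.map_congr rfl fun r _ => ?_)
    rw [Polynomial.eval_mul]
    congr 1
    have := Polynomial.eval_map_apply (f := starRingEnd ℂ) (p := p) (star r)
    simpa using this
  · exact Polynomial.natDegree_mul_le.trans (by simpa using hpq)

theorem HasMoments.aeval_mem_nullIdeal (hφ : IsPositiveTrace φ) (hS : HasMoments φ d a S)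
    {p : Polynomial ℂ} (hp : p.natDegree ≤ d) (hp0 : ∀ r ∈ S, p.eval r = 0) :
    Polynomial.aeval (linForm a) p ∈ nullIdeal hφ := by
  rw [mem_nullIdeal, hS.map_star_mul (by omega)]
  refine Multiset.sum_eq_zero fun x hx => ?_
  obtain ⟨r, hr, rfl⟩ := Multiset.mem_map.mp hx
  rw [hp0 r hr, mul_zero]

/-- The degree bound is removed by the ideal property: `p` is a multiple of the nodal polynomial of
the distinct points, whose degree is at most `d`. -/
theorem HasMoments.aeval_mem_nullIdeal_of_card_le (hφ : IsPositiveTrace φ) (hS : HasMoments φ d a S)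
    (hcard : Multiset.card S ≤ d) {p : Polynomial ℂ} (hp0 : ∀ r ∈ S, p.eval r = 0) :
    Polynomial.aeval (linForm a) p ∈ nullIdeal hφ := by
  classical
  have hdvd : Lagrange.nodal S.toFinset id ∣ p :=
    Finset.prod_dvd_of_coprime
      (fun r _ s _ hrs => Polynomial.pairwise_coprime_X_sub_C Function.injective_id hrs)
      fun r hr => Polynomial.dvd_iff_isRoot.mpr (hp0 r (Multiset.mem_toFinset.mp hr))
  obtain ⟨q, rfl⟩ := hdvd
  rw [map_mul]
  refine TwoSidedIdeal.mul_mem_right _ _ _ (hS.aeval_mem_nullIdeal hφ ?_ fun r hr => ?_)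
  · rw [Lagrange.natDegree_nodal]
    exact (Multiset.toFinset_card_le S).trans hcard
  · exact Lagrange.eval_nodal_at_node (v := id) (Multiset.mem_toFinset.mpr hr)

theorem exists_indicator_polynomial (S : Multiset ℂ) {r : ℂ} (hr : r ∈ S) :
    ∃ p : Polynomial ℂ, p.natDegree + 1 ≤ Multiset.card S ∧ p.eval r = 1 ∧
      ∀ s ∈ S, s ≠ r → p.eval s = 0 := by
  classical
  have hr' := Multiset.mem_toFinset.mpr hr
  refine ⟨Lagrange.basis S.toFinset id r, ?_, ?_, fun s hs hsr => ?_⟩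
  · rw [Lagrange.natDegree_basis Function.injective_id.injOn hr']
    have h1 := Multiset.toFinset_card_le S
    have h2 := Finset.card_pos.mpr ⟨r, hr'⟩
    omega
  · exact Lagrange.eval_basis_self (v := id) Function.injective_id.injOn hr'
  · exact Lagrange.eval_basis_of_ne (v := id) hsr.symm (Multiset.mem_toFinset.mpr hs)

theorem sum_map_eq_count_mul {S : Multiset ℂ} {r : ℂ} {f : ℂ → ℂ}
    (hf : ∀ s ∈ S, s ≠ r → f s = 0) : (S.map f).sum = S.count r * f r := by
  classical
  rw [Multiset.map_congr rfl (g := fun s => if s = r then f r else 0) fun s hs => by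
    split_ifs with hsr
    · rw [hsr]
    · exact hf s hs hsr]
  clear hf
  induction S using Multiset.induction_on with
  | empty => simp
  | cons s S ih =>
    rw [Multiset.map_cons, Multiset.sum_cons, ih, Multiset.count_cons]
    by_cases hsr : s = r
    · subst hsr
      simp
      ring
    · simp [hsr, Ne.symm hsr]

/-- The support of the moments of a self-adjoint element is real. -/
theorem HasMoments.im_eq_zero (hφ : IsPositiveTrace φ) (hS : HasMoments φ d a S)
    (hcard : Multiset.card S ≤ d) (hstar : ∀ r ∈ S, star r ∈ S) {r : ℂ} (hr : r ∈ S) :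
    r.im = 0 := by
  by_contra him
  obtain ⟨p, hdeg, hp1, hp0⟩ := exists_indicator_polynomial S hr
  have hrr : star r ≠ r := fun h => him (Complex.conj_eq_iff_im.mp h)
  -- The only term that could survive is the one at `r`, and its factor `star (p.eval (star r))`
  -- vanishes because `star r` is another point of `S`.
  have hnull : Polynomial.aeval (linForm a) p ∈ nullIdeal hφ := by
    rw [mem_nullIdeal, hS.map_star_mul (by omega), sum_map_eq_count_mul (r := r)]
    · rw [hp0 _ (hstar r hr) hrr]
      simp
    · intro s hs hsr
      rw [hp0 s hs hsr, mul_zero]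
  -- On the other hand, `φ` of this element is the multiplicity of `r`.
  have h0 := map_eq_zero_of_mem_nullIdeal hφ hnull
  rw [hS p (by omega), sum_map_eq_count_mul hp0, hp1, mul_one] at h0
  exact (Multiset.count_pos.mpr hr).ne' (by exact_mod_cast h0)

/-- `a ∙ z` is a hermitian square modulo the null ideal if the moments are supported on the
nonnegative reals. -/
theorem HasMoments.map_star_mul_linForm_mul_nonneg (hφ : IsPositiveTrace φ)
    (hS : HasMoments φ d a S) (hcard : Multiset.card S ≤ d) (hnonneg : ∀ r ∈ S, 0 ≤ r)
    (P : NCPoly n) : 0 ≤ φ (star P * linForm a * P) := by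
  classical
  set s : Polynomial ℂ := Lagrange.interpolate S.toFinset id fun r => (√r.re : ℂ) with hs
  have hsr (r : ℂ) (hr : r ∈ S) : s.eval r = (√r.re : ℂ) :=
    Lagrange.eval_interpolate_at_node (v := id) _ Function.injective_id.injOn
      (Multiset.mem_toFinset.mpr hr)
  -- `s` interpolates the square root on `S`, so `X - s̄ s` vanishes there. Its degree may exceed
  -- `d`, so the version without a degree bound is needed.
  have hnull := hS.aeval_mem_nullIdeal_of_card_le hφ hcard
    (p := Polynomial.X - s.map (starRingEnd ℂ) * s) fun r hr => by
      obtain ⟨x, hx, rfl⟩ : ∃ x : ℝ, 0 ≤ x ∧ (x : ℂ) = r :=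
        ⟨r.re, (Complex.nonneg_iff.mp (hnonneg r hr)).1,
          Complex.ext (by simp) (Complex.nonneg_iff.mp (hnonneg r hr)).2⟩
      have h1 : (s.map (starRingEnd ℂ)).eval (x : ℂ) = (√x : ℂ) := by
        have := Polynomial.eval_map_apply (f := starRingEnd ℂ) (p := s) (x : ℂ)
        rw [hsr _ hr, Complex.conj_ofReal, Complex.conj_ofReal] at this
        exact this
      rw [Polynomial.eval_sub, Polynomial.eval_mul, h1, hsr _ hr, Polynomial.eval_X,
        Complex.ofReal_re, ← Complex.ofReal_mul, Real.mul_self_sqrt hx, sub_self]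
  rw [map_sub, map_mul, Polynomial.aeval_X, ← star_aeval_linForm] at hnull
  set t := Polynomial.aeval (linForm a) s with ht
  have h0 := map_eq_zero_of_mem_nullIdeal hφ
    (TwoSidedIdeal.mul_mem_right _ _ P (TwoSidedIdeal.mul_mem_left _ (star P) _ hnull))
  have h1 := hφ.nonneg (t * P)
  rw [mul_sub, sub_mul, map_sub, sub_eq_zero] at h0
  rw [h0]
  simpa [star_mul, mul_assoc] using h1

/-- For the Lagrange indicator of `r`, the form takes the value `S.count r * r`. The indicator has
degree at most `d - 1`, so the moments involved have order at most `2 * d - 1`. -/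
theorem HasMoments.nonneg_of_map_star_mul_linForm_mul_nonneg (hS : HasMoments φ d a S)
    (hcard : Multiset.card S ≤ d) (hreal : ∀ r ∈ S, r.im = 0)
    (hnonneg : ∀ p : Polynomial ℂ, p.natDegree < d →
      0 ≤ φ (star (Polynomial.aeval (linForm a) p) * linForm a * Polynomial.aeval (linForm a) p))
    {r : ℂ} (hr : r ∈ S) : 0 ≤ r := by
  obtain ⟨p, hdeg, hp1, hp0⟩ := exists_indicator_polynomial S hr
  have h1 := hnonneg p (by omega)
  have h2 := hS.map_star_mul (p := p) (q := Polynomial.X * p)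
    (by have := Polynomial.natDegree_mul_le (p := (Polynomial.X : Polynomial ℂ)) (q := p)
        rw [Polynomial.natDegree_X] at this
        omega)
  rw [map_mul (Polynomial.aeval (linForm a)), Polynomial.aeval_X, ← mul_assoc] at h2
  rw [h2, sum_map_eq_count_mul (r := r)] at h1
  · have hstar : star r = r := Complex.conj_eq_iff_im.mpr (hreal r hr)
    rw [hstar, Polynomial.eval_mul, hp1, Polynomial.eval_X, star_one, one_mul, mul_one] at h1
    have hpos : (0 : ℝ) < (S.count r : ℝ) := by exact_mod_cast Multiset.count_pos.mpr hr
    have h3 := (Complex.nonneg_iff.mp h1).1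
    rw [← Complex.ofReal_natCast, Complex.re_ofReal_mul] at h3
    exact Complex.nonneg_iff.mpr ⟨nonneg_of_mul_nonneg_right h3 hpos, (hreal r hr).symm⟩
  · intro s hs hsr
    rw [Polynomial.eval_mul, hp0 s hs hsr, mul_zero, mul_zero]

end Moments

/-! ### The matrix pencil on short words. -/

section Spectrahedral

variable {n d : ℕ}

theorem isSpectrahedral_of_fintype {ι : Type*} [Fintype ι] {T : Set (Fin n → ℝ)}
    (M : Fin n → Matrix ι ι ℂ) (hM : ∀ i, (M i).IsHermitian)
    (hT : T = {a | (∑ i, (a i : ℂ) • M i).PosSemidef}) : IsSpectrahedral T := by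
  refine ⟨Fintype.card ι, fun i => (M i).submatrix (Fintype.equivFin ι).symm
    (Fintype.equivFin ι).symm, fun i => (hM i).submatrix _, ?_⟩
  rw [hT]
  ext a
  have : ∑ i, (a i : ℂ) • (M i).submatrix (Fintype.equivFin ι).symm (Fintype.equivFin ι).symm
      = (∑ i, (a i : ℂ) • M i).submatrix (Fintype.equivFin ι).symm (Fintype.equivFin ι).symm := by
    ext u v
    simp [Matrix.sum_apply]
  change _ ↔ Matrix.PosSemidef _
  rw [this, Matrix.posSemidef_submatrix_equiv]
  rfl

/-- Words of length less than `d`. -/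
abbrev ShortWord (n d : ℕ) : Type := Σ k : Fin d, (Fin k → Fin n)

/-- The noncommutative polynomial of degree less than `d` with coefficients `x`. -/
noncomputable def ofCoeffs (x : ShortWord n d → ℂ) : NCPoly n := ∑ w, x w • wordOf w.2

/-- This makes the Lagrange indicators available as test vectors for one pencil whose size does not
depend on `a`. -/
theorem exists_ofCoeffs_eq_aeval (a : Fin n → ℝ) {p : Polynomial ℂ} (hp : p.natDegree < d) :
    ∃ x : ShortWord n d → ℂ, ofCoeffs x = Polynomial.aeval (linForm a) p := by
  refine ⟨fun w => p.coeff w.1 * ((∏ j, a (w.2 j) : ℝ) : ℂ), ?_⟩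
  rw [Polynomial.aeval_eq_sum_range' hp, ofCoeffs, Fintype.sum_sigma, Finset.sum_range]
  refine Finset.sum_congr rfl fun k _ => ?_
  rw [linForm_pow, Finset.smul_sum]
  exact Finset.sum_congr rfl fun w _ => mul_smul _ _ _

/-- The compression of multiplication by `zᵢ` to polynomials of degree less than `d`. -/
noncomputable def compression (φ : NCPoly n →ₗ[ℂ] ℂ) (d : ℕ) (i : Fin n) :
    Matrix (ShortWord n d) (ShortWord n d) ℂ :=
  Matrix.of fun u v => φ (star (wordOf u.2) * z i * wordOf v.2)

theorem compression_isHermitian {φ : NCPoly n →ₗ[ℂ] ℂ} (hφ : IsPositiveTrace φ) (i : Fin n) :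
    (compression φ d i).IsHermitian := by
  ext u v
  simp only [Matrix.conjTranspose_apply, compression, Matrix.of_apply]
  rw [← hφ.map_star]
  simp only [star_mul, star_star, star_z, mul_assoc]

/-- This turns semidefiniteness of the pencil into positivity of `φ (P* (a ∙ z) P)` for `P` of
degree below `d`. Null vectors need not be divided out, as they do not affect semidefiniteness. -/
theorem dotProduct_sum_compression (φ : NCPoly n →ₗ[ℂ] ℂ) (a : Fin n → ℝ)
    (x : ShortWord n d → ℂ) :
    star x ⬝ᵥ ((∑ i, (a i : ℂ) • compression φ d i).mulVec x)
      = φ (star (ofCoeffs x) * linForm a * ofCoeffs x) := by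
  have hentry (u v : ShortWord n d) : (∑ i, (a i : ℂ) • compression φ d i) u v
      = φ (star (wordOf u.2) * linForm a * wordOf v.2) := by
    simp [Matrix.sum_apply, compression, linForm, Finset.mul_sum, Finset.sum_mul]
  simp only [dotProduct, Matrix.mulVec, hentry, Pi.star_apply, ofCoeffs, star_sum, star_smul,
    Finset.sum_mul, Finset.mul_sum, smul_mul_assoc, mul_smul_comm, map_sum, map_smul, smul_eq_mul]
  rw [Finset.sum_comm]
  refine Finset.sum_congr rfl fun v _ => Finset.sum_congr rfl fun u _ => ?_
  ring

end Spectrahedral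

end NCHyperbolic

/-! ### Proof of the theorem. -/

theorem mainTheorem5 (n d : ℕ) (h : MvPolynomial (Fin n) ℝ) (e : Fin n → ℝ)
    (hd : h.IsHomogeneous d) (he : MvPolynomial.eval e h ≠ 0)
    (φ : NCHyperbolic.NCPoly n →ₗ[ℂ] ℂ) (hφ : NCHyperbolic.IsPositiveTrace φ)
    (hc : ∀ α : Fin n →₀ ℕ, ∑ i, α i ≤ 2 * d →
      φ (NCHyperbolic.symWord α) = (NCHyperbolic.newtonCoeff h e α : ℂ)) :
    NCHyperbolic.IsHyperbolic h e ∧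
      (∀ p ∈ NCHyperbolic.cliffordIdeal h e, φ p = 0) ∧
      NCHyperbolic.IsSpectrahedral (NCHyperbolic.hyperbolicityCone h e) := by
  open NCHyperbolic in
  have hS := hasMoments_lineZeros hd he hc
  have hcard (a : Fin n → ℝ) := (card_lineZeros hd he a).le
  have hreal (a : Fin n → ℝ) : ∀ r ∈ lineZeros h e a, r.im = 0 := fun r hr =>
    (hS a).im_eq_zero hφ (hcard a) (fun _ => star_mem_lineZeros hd he) hr
  refine ⟨⟨⟨d, hd⟩, he, hreal⟩, fun p hp => map_eq_zero_of_mem_nullIdeal hφ ?_, ?_⟩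
  · refine TwoSidedIdeal.span_le.mpr ?_ hp
    rintro _ (⟨a, rfl⟩ | rfl)
    · change Polynomial.aeval (linForm a) (lineRestriction h e a) ∈ nullIdeal hφ
      rw [← Polynomial.aeval_map_algebraMap ℂ]
      refine (hS a).aeval_mem_nullIdeal_of_card_le hφ (hcard a) fun r hr => ?_
      rw [Polynomial.eval_map_algebraMap]
      exact (mem_lineZeros hd he).mp hr
    -- Every zero of `h_{e,e}(t) = (1 - t) ^ d * h(e)` equals `1`, so `1 - X` vanishes on the zeros.
    · have := (hS e).aeval_mem_nullIdeal_of_card_le hφ (hcard e) (p := 1 - Polynomial.X)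
        fun r hr => by simp [eq_one_of_mem_lineZeros_self hd he hr]
      simpa using this
  · refine isSpectrahedral_of_fintype (compression φ d) (compression_isHermitian hφ) ?_
    ext a
    change (∀ r ∈ lineZeros h e a, 0 ≤ r) ↔ Matrix.PosSemidef _
    rw [Matrix.posSemidef_iff_dotProduct_mulVec]
    simp only [dotProduct_sum_compression]
    refine ⟨fun ha => ⟨?_, fun x => (hS a).map_star_mul_linForm_mul_nonneg hφ (hcard a) ha _⟩,
      fun ha r hr => (hS a).nonneg_of_map_star_mul_linForm_mul_nonneg (hcard a) (hreal a)
        (fun p hp => ?_) hr⟩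
    · refine isSelfAdjoint_sum _ fun i _ => ?_
      exact IsSelfAdjoint.smul (Complex.conj_ofReal _) (compression_isHermitian hφ i)
    · obtain ⟨x, hx⟩ := exists_ofCoeffs_eq_aeval a hp
      rw [← hx]
      exact ha.2 x
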